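/- Let $A,B\subset\mathbb{R}^3$ be convex polytopes (convex hulls of finite sets) such that the Minkowski sum $V_{AB}=(-A)\oplus B=\{b-a: a\in A,\ b\in B\}$ has nonempty interior. Let $\mu\in\mathbb{R}^3$, let $\Sigma\in\mathbb{R}^{3\times3}$ be symmetric positive definite, let $r>0$, and let $$g(x;\mu,\Sigma)=\frac{1}{\sqrt{(2\pi)^3\det\Sigma}}\exp\Bigl(-\tfrac12(x-\mu)^T\Sigma^{-1}(x-\mu)\Bigr)$$ be the Gaussian density. Let $V_{TG}=\{x:(x-\mu)^T\Sigma^{-1}(x-\mu)\le r^2\}$ and $\eta=\int_{V_{TG}}g(x;\mu,\Sigma)\,dx$. The truncated Gaussian density is $f_{TG}=\frac1\eta\, g(\cdot\,;\mu,\Sigma)$ on $V_{TG}$ and $f_{TG}=0$ elsewhere, and the collision probability is $p_{col}=\int_{V_{AB}}f_{TG}(x)\,dx$. Let $T(x)=\Sigma^{-1/2}(x-\mu)$ be the whitening transform, and let $V'_{AB}=T(V_{AB})$, $V'_{TG}=T(V_{TG})$ (the closed ball of radius $r$ about the origin), $V'=V'_{AB}\cap V'_{TG}$. Assume that $0\notin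 V'_{AB}$. Let $\mathbf d'\neq0$ be the minimum distance vector between $V'_{AB}$ and the origin, oriented from the point of $V'_{AB}$ nearest to the origin towards the origin (so $-\mathbf d'$ is that nearest point). Let $\mathbf n'_d=\mathbf d'/\|\mathbf d'\|$ and $$\mathbf F(x)=\frac1{2\pi}\Bigl(1+\operatorname{erf}\Bigl(\frac{x\cdot\mathbf n'_d}{\sqrt2}\Bigr)\Bigr)\mathbf n'_d .$$ Let the boundary of $V'_{AB}$ be triangulated by finitely many nondegenerate triangles $\triangle_i$, any two of which overlap in a set of zero area, with unit normals $\mathbf n_i$ pointing out of $V'_{AB}$, and let $S_i=\triangle_i\cap V'_{TG}$ be the part of $\triangle_i$ inside the truncation ball. Then $$\eta\,p_{col}=\int_{V'}g(x;0,I)\,dx\ \le\ \sum_i\iint_{S_i}(\mathbf F\cdot\mathbf n_i)\,dS+\pi(1-\eta)\|\mathbf d'\|^2 .$$ If $\eta\ge\frac12$, then $p_{col}$ itself is also at most the right-hand side. Moreover $\sup_{x\in\mathbb{R}^3}\|\mathbf F(x)\|=1/\pi$. -/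

import Mathlib

open MeasureTheory
open scoped Pointwise

/-- Three-dimensional Euclidean space. -/
abbrev E3 : Type := EuclideanSpace ℝ (Fin 3)

/-- The error function `erf t = (2 / √π) ∫₀ᵗ exp (-s²) ds`. -/
noncomputable def erf (t : ℝ) : ℝ :=
  2 / √Real.pi * ∫ s in (0 : ℝ)..t, Real.exp (-s ^ 2)

/-- The quadratic form `(x - μ)ᵀ Σ⁻¹ (x - μ)`. -/
noncomputable def mahalanobisSq (μ : E3) (Sig : Matrix (Fin 3) (Fin 3) ℝ) (x : E3) : ℝ :=
  dotProduct (x - μ).ofLp (Matrix.mulVec Sig⁻¹ (x - μ).ofLp)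

/-- The density `g(x; μ, Σ)` of the Gaussian on `ℝ³` with mean `μ` and covariance matrix `Σ`. -/
noncomputable def gaussianDensity (μ : E3) (Sig : Matrix (Fin 3) (Fin 3) ℝ) (x : E3) : ℝ :=
  1 / √((2 * Real.pi) ^ 3 * Sig.det) * Real.exp (-(1 / 2) * mahalanobisSq μ Sig x)

/-- The domain `V_TG` of the truncated Gaussian: the ellipsoid of radius `r` in the coordinates of
the principal axes. -/
def truncationDomain (μ : E3) (Sig : Matrix (Fin 3) (Fin 3) ℝ) (r : ℝ) : Set E3 :=
  {x | mahalanobisSq μ Sig x ≤ r ^ 2}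

/-- The truncation rate `η`: the mass that the Gaussian gives to the truncation domain. -/
noncomputable def truncationRate (μ : E3) (Sig : Matrix (Fin 3) (Fin 3) ℝ) (r : ℝ) : ℝ :=
  ∫ x in truncationDomain μ Sig r, gaussianDensity μ Sig x

open Classical in
/-- The density `f_TG(x; μ, Σ, r)` of the truncated Gaussian. -/
noncomputable def truncatedGaussianDensity (μ : E3) (Sig : Matrix (Fin 3) (Fin 3) ℝ) (r : ℝ)
    (x : E3) : ℝ :=
  if x ∈ truncationDomain μ Sig r then
    1 / truncationRate μ Sig r * gaussianDensity μ Sig x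
  else 0

/-- A convex polytope in `ℝ³`: the convex hull of a finite set. -/
def IsConvexPolytope (A : Set E3) : Prop :=
  ∃ s : Finset E3, A = convexHull ℝ (s : Set E3)

/-- The Minkowski sum `V_AB = (-A) ⊕ B`. -/
def minkowskiRegion (A B : Set E3) : Set E3 := -A + B

/-- The collision probability of `A + ε` with `B` for a truncated Gaussian displacement `ε`: the
integral of the truncated Gaussian density over `V_AB`. -/
noncomputable def collisionProb (A B : Set E3) (μ : E3) (Sig : Matrix (Fin 3) (Fin 3) ℝ)
    (r : ℝ) : ℝ :=
  ∫ x in minkowskiRegion A B, truncatedGaussianDensity μ Sig r x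

open scoped MatrixOrder in
/-- The whitening transform `T x = Σ^{-1/2} (x - μ)`. -/
noncomputable def whiten (μ : E3) (Sig : Matrix (Fin 3) (Fin 3) ℝ) (x : E3) : E3 :=
  Matrix.toEuclideanCLM (𝕜 := ℝ) (n := Fin 3) (CFC.sqrt Sig⁻¹) (x - μ)

/-- `d` is the minimum distance vector between `V` and the origin: the vector that leads from the
point of `V` nearest to the origin to the origin. -/
def IsMinDistVec (V : Set E3) (d : E3) : Prop :=
  -d ∈ V ∧ ∀ y ∈ V, ‖d‖ ≤ ‖y‖

/-- The unit vector in the direction of `d`. -/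
noncomputable def unitDir (d : E3) : E3 := ‖d‖⁻¹ • d

/-- The vector field `F(x) = (1 / 2π) (1 + erf (x · n / √2)) n`, with values along `n`. -/
noncomputable def erfField (n : E3) (x : E3) : E3 :=
  (1 / (2 * Real.pi) * (1 + erf (inner ℝ x n / √2))) • n

/-- The nondegenerate triangles `S i`, with normal vectors `n i`, form a triangulated surface which
is the boundary of the convex body `V`: they cover the boundary, two different triangles overlap in
a set of zero area, and `n i` is the unit normal of the `i`-th triangle that points out of `V`. -/
structure IsBoundaryTriangulation {ι : Type*} (V : Set E3) (S : ι → Affine.Triangle ℝ E3)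
    (n : ι → E3) : Prop where
  cover : ⋃ i, (S i).closedInterior = frontier V
  overlap : ∀ i j, i ≠ j →
    Measure.euclideanHausdorffMeasure 2 ((S i).closedInterior ∩ (S j).closedInterior) = 0
  unit : ∀ i, ‖n i‖ = 1
  normal : ∀ i, ∀ x ∈ (S i).closedInterior, ∀ y ∈ (S i).closedInterior, inner ℝ (n i) (x - y) = 0
  outward : ∀ i, ∀ x ∈ (S i).closedInterior, ∀ y ∈ V, inner ℝ (n i) (y - x) ≤ 0

/-- The flux `∬ (F · n) dS` of the vector field `F` through the part of the triangle `S` in `K`,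
where `dS` is the area measure (two-dimensional Hausdorff measure). -/
noncomputable def flux (F : E3 → E3) (S : Affine.Triangle ℝ E3) (K : Set E3) (n : E3) : ℝ :=
  ∫ x in S.closedInterior ∩ K, inner ℝ (F x) n ∂(Measure.euclideanHausdorffMeasure 2)

/-! After whitening, the truncated mass is the standard Gaussian mass of a convex body `V` inside a
ball. With m the unit vector along d', the field F = `erfProfile` (x·m) m has divergence
`erfProfileDeriv` (x·m), which depends on the height x·m only. Since (x·m)² ≤ ‖x‖², this divergence
is at least twice the Gaussian density (`two_mul_gaussianDensity_le`).

It remains to bound the integral of div F by the flux through the flat boundary pieces in the ball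
(`setIntegral_deriv_le_sum_flux`). As -d' is the point of `V` nearest to 0, the body lies in the
half-space x·m ≤ 0. There F, a nonnegative multiple of m, points into the ball along the sphere, so
the flux dropped with the spherical part is nonpositive. No divergence theorem is invoked: Fubini
reduces the claim to lines parallel to m, where it is the fundamental theorem of calculus
(`integral_fiber_le_sum_fiberFlux`), and the area formula for planes
(`map_planeLift_eq_smul_restrict`) turns sums over lines back into surface integrals.

Thus twice the Gaussian mass is at most the flux. The spare factor 2 gives the bound for the
collision probability when η ≥ 1/2; the term with ‖d'‖² only has to be nonnegative. -/

/-! ### The error function and the size of the field. -/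

/-- The magnitude `(1 / 2π) (1 + erf (t / √2))` of the field `erfField` at signed height `t`. -/
noncomputable def erfProfile (t : ℝ) : ℝ :=
  1 / (2 * Real.pi) * (1 + erf (t / √2))

/-- The derivative of `erfProfile`. -/
noncomputable def erfProfileDeriv (t : ℝ) : ℝ :=
  1 / Real.pi * (1 / √(2 * Real.pi)) * Real.exp (-(1 / 2) * t ^ 2)

theorem hasDerivAt_erf (t : ℝ) :
    HasDerivAt erf (2 / √Real.pi * Real.exp (-t ^ 2)) t := by
  have hc : Continuous fun s : ℝ => Real.exp (-s ^ 2) := by fun_prop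
  exact (hc.integral_hasStrictDerivAt 0 t).hasDerivAt.const_mul _

theorem hasDerivAt_erfProfile (t : ℝ) : HasDerivAt erfProfile (erfProfileDeriv t) t := by
  have h := (((hasDerivAt_erf (t / √2)).comp t ((hasDerivAt_id t).div_const (√2))).const_add
    1).const_mul (1 / (2 * Real.pi))
  refine h.congr_deriv ?_
  have h2 : √(2 * Real.pi) = √2 * √Real.pi := Real.sqrt_mul (by norm_num) _
  have h3 : -(t / √2) ^ 2 = -(1 / 2) * t ^ 2 := by
    rw [div_pow, Real.sq_sqrt (by norm_num)]; ring
  rw [erfProfileDeriv, h2, h3]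
  field_simp

theorem continuous_erfProfileDeriv : Continuous erfProfileDeriv := by
  unfold erfProfileDeriv; fun_prop

theorem erfProfileDeriv_nonneg (t : ℝ) : 0 ≤ erfProfileDeriv t := by
  unfold erfProfileDeriv; positivity

theorem tendsto_erf_atTop : Filter.Tendsto erf Filter.atTop (nhds 1) := by
  have hi : IntegrableOn (fun s : ℝ => Real.exp (-s ^ 2)) (Set.Ioi 0) := by
    simpa using (integrable_exp_neg_mul_sq one_pos).integrableOn (s := Set.Ioi (0 : ℝ))
  have h := (intervalIntegral_tendsto_integral_Ioi 0 hi Filter.tendsto_id).const_mul (2 / √Real.pi)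
  have hv : ∫ s in Set.Ioi (0 : ℝ), Real.exp (-s ^ 2) = √Real.pi / 2 := by
    simpa using integral_gaussian_Ioi 1
  rw [hv] at h
  have h1 : 2 / √Real.pi * (√Real.pi / 2) = 1 := by
    have : √Real.pi ≠ 0 := by positivity
    field_simp
  rwa [h1] at h

theorem erf_neg (t : ℝ) : erf (-t) = -erf t := by
  have h := intervalIntegral.integral_comp_neg (a := 0) (b := t) fun s => Real.exp (-s ^ 2)
  simp only [neg_zero, neg_sq] at h
  rw [erf, erf, intervalIntegral.integral_symm, ← h, mul_neg]

theorem monotone_erf : Monotone erf :=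
  monotone_of_hasDerivAt_nonneg hasDerivAt_erf fun t => by positivity

theorem erf_le_one (t : ℝ) : erf t ≤ 1 :=
  monotone_erf.ge_of_tendsto tendsto_erf_atTop t

theorem neg_one_le_erf (t : ℝ) : -1 ≤ erf t := by
  have := erf_le_one (-t)
  rw [erf_neg] at this
  linarith

theorem erfProfile_nonneg (t : ℝ) : 0 ≤ erfProfile t := by
  have := neg_one_le_erf (t / √2)
  exact mul_nonneg (by positivity) (by linarith)

theorem norm_erfField {n : E3} (hn : ‖n‖ = 1) (x : E3) :
    ‖erfField n x‖ = erfProfile (inner ℝ x n) := by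
  rw [erfField, norm_smul, hn, mul_one]
  exact abs_of_nonneg (erfProfile_nonneg _)

/-- Since erf ≤ 1, the value 1/π is an upper bound; it is the limit along the ray t • n as t → ∞. -/
theorem isLUB_range_norm_erfField {n : E3} (hn : ‖n‖ = 1) :
    IsLUB (Set.range fun x => ‖erfField n x‖) (1 / Real.pi) := by
  have hpi : 1 / (2 * Real.pi) * (1 + 1) = 1 / Real.pi := by field_simp; norm_num
  refine ⟨?_, fun b hb => ?_⟩
  · rintro _ ⟨x, rfl⟩
    simp only [norm_erfField hn]
    rw [← hpi, erfProfile]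
    have := erf_le_one (inner ℝ x n / √2)
    gcongr
  · have hlim : Filter.Tendsto erfProfile Filter.atTop (nhds (1 / Real.pi)) := by
      rw [← hpi]
      exact ((tendsto_erf_atTop.comp (Filter.tendsto_id.atTop_div_const
        (by positivity : (0 : ℝ) < √2))).const_add 1).const_mul _
    refine le_of_tendsto hlim (Filter.Eventually.of_forall fun t => ?_)
    refine hb ⟨t • n, ?_⟩
    simp only [norm_erfField hn]
    rw [real_inner_smul_left, real_inner_self_eq_norm_sq, hn]
    norm_num

/-! ### Whitening as an affine change of variables. -/

section Whitening

open scoped MatrixOrder Matrix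

theorem sqrt_inv_mul_self {Sig : Matrix (Fin 3) (Fin 3) ℝ} (hSig : Sig.PosDef) :
    CFC.sqrt Sig⁻¹ * CFC.sqrt Sig⁻¹ = Sig⁻¹ :=
  CFC.sqrt_mul_sqrt_self _ hSig.inv.posSemidef.nonneg

theorem transpose_sqrt (M : Matrix (Fin 3) (Fin 3) ℝ) : (CFC.sqrt M)ᵀ = CFC.sqrt M := by
  have h : IsSelfAdjoint (CFC.sqrt M) := .of_nonneg (CFC.sqrt_nonneg M)
  simpa [Matrix.star_eq_conjTranspose] using h.star_eq

theorem abs_det_sqrt_inv {Sig : Matrix (Fin 3) (Fin 3) ℝ} (hSig : Sig.PosDef) :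
    |(CFC.sqrt Sig⁻¹).det| = 1 / √Sig.det := by
  have h := congrArg Matrix.det (sqrt_inv_mul_self hSig)
  rw [Matrix.det_mul, Matrix.det_nonsing_inv, Ring.inverse_eq_inv'] at h
  rw [← Real.sqrt_mul_self_eq_abs, h, Real.sqrt_inv, one_div]

/-- Σ⁻¹ is the square of a symmetric root, and one factor can be moved to the other side of the
inner product. -/
theorem mahalanobisSq_eq_norm_whiten_sq (μ : E3) {Sig : Matrix (Fin 3) (Fin 3) ℝ}
    (hSig : Sig.PosDef) (x : E3) : mahalanobisSq μ Sig x = ‖whiten μ Sig x‖ ^ 2 := by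
  rw [← real_inner_self_eq_norm_sq, whiten, Matrix.inner_toEuclideanCLM,
    Matrix.ofLp_toEuclideanCLM, mahalanobisSq]
  conv_lhs => rw [← sqrt_inv_mul_self hSig]
  rw [← Matrix.mulVec_mulVec, Matrix.dotProduct_mulVec, ← Matrix.mulVec_transpose, transpose_sqrt]

theorem gaussianDensity_zero_one (x : E3) :
    gaussianDensity 0 1 x = 1 / √((2 * Real.pi) ^ 3) * Real.exp (-(1 / 2) * ‖x‖ ^ 2) := by
  have h : mahalanobisSq 0 1 x = ‖x‖ ^ 2 := by
    rw [← real_inner_self_eq_norm_sq, mahalanobisSq, EuclideanSpace.inner_eq_star_dotProduct]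
    simp
  rw [gaussianDensity, h, Matrix.det_one, mul_one]

theorem gaussianDensity_eq_whiten (μ : E3) {Sig : Matrix (Fin 3) (Fin 3) ℝ}
    (hSig : Sig.PosDef) (x : E3) :
    gaussianDensity μ Sig x
      = |(CFC.sqrt Sig⁻¹).det| * gaussianDensity 0 1 (whiten μ Sig x) := by
  rw [gaussianDensity_zero_one, gaussianDensity, mahalanobisSq_eq_norm_whiten_sq μ hSig,
    abs_det_sqrt_inv hSig, Real.sqrt_mul (by positivity)]
  ring

theorem bijective_whiten (μ : E3) {Sig : Matrix (Fin 3) (Fin 3) ℝ} (hSig : Sig.PosDef) :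
    Function.Bijective (whiten μ Sig) := by
  have hdet : IsUnit (CFC.sqrt Sig⁻¹).det := by
    rw [isUnit_iff_ne_zero, ← abs_pos, abs_det_sqrt_inv hSig]
    have := hSig.det_pos
    positivity
  refine Function.bijective_iff_has_inverse.2
    ⟨fun y => Matrix.toEuclideanCLM (𝕜 := ℝ) (n := Fin 3) (CFC.sqrt Sig⁻¹)⁻¹ y + μ,
      fun x => ?_, fun y => ?_⟩
  · simp only [whiten]
    rw [← mul_apply_eq_comp, ← map_mul, Matrix.nonsing_inv_mul _ hdet,
      map_one, one_apply_eq_self, sub_add_cancel]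
  · rw [whiten, add_sub_cancel_right, ← mul_apply_eq_comp, ← map_mul,
      Matrix.mul_nonsing_inv _ hdet, map_one, one_apply_eq_self]

/-- The Jacobian |det Σ^{-1/2}| is exactly the ratio of the normalising constants of the two
Gaussians. -/
theorem setIntegral_whiten_image (μ : E3) {Sig : Matrix (Fin 3) (Fin 3) ℝ} (hSig : Sig.PosDef)
    {s : Set E3} (hs : MeasurableSet s) :
    ∫ x in whiten μ Sig '' s, gaussianDensity 0 1 x = ∫ x in s, gaussianDensity μ Sig x := by
  have hf : ∀ x ∈ s, HasFDerivWithinAt (whiten μ Sig)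
      (Matrix.toEuclideanCLM (𝕜 := ℝ) (n := Fin 3) (CFC.sqrt Sig⁻¹)) s x := fun x _ =>
    ((Matrix.toEuclideanCLM (𝕜 := ℝ) (n := Fin 3) (CFC.sqrt Sig⁻¹)).hasFDerivAt.comp x
      ((hasFDerivAt_id x).sub_const μ)).hasFDerivWithinAt
  have hdet : (Matrix.toEuclideanCLM (𝕜 := ℝ) (n := Fin 3) (CFC.sqrt Sig⁻¹)).det
      = (CFC.sqrt Sig⁻¹).det := by
    exact (congrArg LinearMap.det (DFunLike.congr_fun (Matrix.toLpLin_eq_toLin 2 2) _)).trans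
      (LinearMap.det_toLin _ _)
  rw [integral_image_eq_integral_abs_det_fderiv_smul _ hs hf (bijective_whiten μ hSig).1.injOn]
  simp only [hdet, gaussianDensity_eq_whiten μ hSig, smul_eq_mul]

theorem continuous_whiten (μ : E3) (Sig : Matrix (Fin 3) (Fin 3) ℝ) :
    Continuous (whiten μ Sig) := by
  unfold whiten; fun_prop

theorem convex_whiten_image (μ : E3) (Sig : Matrix (Fin 3) (Fin 3) ℝ) {s : Set E3}
    (hs : Convex ℝ s) : Convex ℝ (whiten μ Sig '' s) := by
  have h := (hs.sub (convex_singleton μ)).linear_image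
    (Matrix.toEuclideanCLM (𝕜 := ℝ) (n := Fin 3) (CFC.sqrt Sig⁻¹) : E3 →ₗ[ℝ] E3)
  rw [Set.sub_singleton, Set.image_image] at h
  exact h

theorem nonempty_interior_whiten_image (μ : E3) {Sig : Matrix (Fin 3) (Fin 3) ℝ}
    (hSig : Sig.PosDef) {s : Set E3} (hs : (interior s).Nonempty) :
    (interior (whiten μ Sig '' s)).Nonempty := by
  set L : E3 →L[ℝ] E3 := Matrix.toEuclideanCLM (𝕜 := ℝ) (n := Fin 3) (CFC.sqrt Sig⁻¹)
  have hL : Function.Surjective L := fun y => by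
    obtain ⟨x, hx⟩ := (bijective_whiten μ hSig).2 y
    exact ⟨x - μ, hx⟩
  have hopen : IsOpenMap (whiten μ Sig) :=
    (L.isOpenMap hL).comp (Homeomorph.subRight μ).isOpenMap
  exact (hs.image _).mono (hopen.image_interior_subset s)

theorem whiten_image_truncationDomain (μ : E3) {Sig : Matrix (Fin 3) (Fin 3) ℝ}
    (hSig : Sig.PosDef) {r : ℝ} (hr : 0 < r) :
    whiten μ Sig '' truncationDomain μ Sig r = Metric.closedBall 0 r := by
  have h : truncationDomain μ Sig r = whiten μ Sig ⁻¹' Metric.closedBall 0 r := by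
    ext x
    rw [truncationDomain, Set.mem_ofPred_eq, mahalanobisSq_eq_norm_whiten_sq μ hSig,
      Set.mem_preimage, mem_closedBall_zero_iff, sq_le_sq₀ (norm_nonneg _) hr.le]
  rw [h, Set.image_preimage_eq _ (bijective_whiten μ hSig).2]

theorem measurableSet_truncationDomain (μ : E3) {Sig : Matrix (Fin 3) (Fin 3) ℝ}
    (hSig : Sig.PosDef) (r : ℝ) : MeasurableSet (truncationDomain μ Sig r) := by
  simp only [truncationDomain, mahalanobisSq_eq_norm_whiten_sq μ hSig]
  exact (isClosed_le ((continuous_whiten μ Sig).norm.pow 2) continuous_const).measurableSet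

end Whitening

/-! ### Gaussian mass and the truncation rate. -/

theorem integrable_gaussianDensity_zero_one : Integrable (gaussianDensity 0 1) := by
  have h := GaussianFourier.integrable_cexp_neg_mul_sq_norm_add (V := E3) (b := 1 / 2)
    (by norm_num) 0 0
  have h' := h.norm
  simp only [Complex.norm_exp] at h'
  refine (h'.const_mul (1 / √((2 * Real.pi) ^ 3))).congr (ae_of_all _ fun x => ?_)
  simp only [gaussianDensity_zero_one]
  congr 2
  rw [zero_mul, add_zero, ← Complex.ofReal_pow]
  have : (-(1 / 2 : ℂ)) = ((-(1 / 2) : ℝ) : ℂ) := by push_cast; rfl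
  rw [this, ← Complex.ofReal_mul, Complex.ofReal_re]

theorem integral_gaussianDensity_zero_one : ∫ x, gaussianDensity 0 1 x = 1 := by
  simp only [gaussianDensity_zero_one]
  rw [integral_const_mul, GaussianFourier.integral_rexp_neg_mul_sq_norm (by norm_num)]
  have h3 : (Module.finrank ℝ E3 : ℝ) / 2 = 3 * (1 / 2) := by
    rw [finrank_euclideanSpace_fin]; norm_num
  have h2 : Real.pi / (1 / 2) = 2 * Real.pi := by ring
  rw [h3, h2, Real.rpow_mul (by positivity), ← Real.sqrt_eq_rpow]
  have : ((2 * Real.pi) ^ (3 : ℝ)) = (2 * Real.pi) ^ 3 := by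
    rw [← Real.rpow_natCast]; norm_num
  rw [this]
  have : √((2 * Real.pi) ^ 3) ≠ 0 := by positivity
  field_simp

theorem gaussianDensity_zero_one_pos (x : E3) : 0 < gaussianDensity 0 1 x := by
  rw [gaussianDensity_zero_one]; positivity

theorem truncationRate_eq (μ : E3) {Sig : Matrix (Fin 3) (Fin 3) ℝ}
    (hSig : Sig.PosDef) {r : ℝ} (hr : 0 < r) :
    truncationRate μ Sig r = ∫ x in Metric.closedBall 0 r, gaussianDensity 0 1 x := by
  rw [truncationRate, ← setIntegral_whiten_image μ hSig (measurableSet_truncationDomain μ hSig r),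
    whiten_image_truncationDomain μ hSig hr]

theorem truncationRate_le_one (μ : E3) {Sig : Matrix (Fin 3) (Fin 3) ℝ}
    (hSig : Sig.PosDef) {r : ℝ} (hr : 0 < r) : truncationRate μ Sig r ≤ 1 := by
  rw [truncationRate_eq μ hSig hr, ← integral_gaussianDensity_zero_one]
  exact setIntegral_le_integral integrable_gaussianDensity_zero_one
    (ae_of_all _ fun x => (gaussianDensity_zero_one_pos x).le)

theorem truncationRate_pos (μ : E3) {Sig : Matrix (Fin 3) (Fin 3) ℝ}
    (hSig : Sig.PosDef) {r : ℝ} (hr : 0 < r) : 0 < truncationRate μ Sig r := by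
  rw [truncationRate_eq μ hSig hr, setIntegral_pos_iff_support_of_nonneg_ae
    (ae_of_all _ fun x => (gaussianDensity_zero_one_pos x).le)
    integrable_gaussianDensity_zero_one.integrableOn]
  rw [Function.support_eq_univ fun x => (gaussianDensity_zero_one_pos x).ne', Set.univ_inter]
  exact Metric.measure_closedBall_pos _ _ hr

theorem truncationRate_mul_collisionProb {A B : Set E3} (hAB : MeasurableSet (minkowskiRegion A B))
    (μ : E3) {Sig : Matrix (Fin 3) (Fin 3) ℝ} (hSig : Sig.PosDef) {r : ℝ} (hr : 0 < r) :
    truncationRate μ Sig r * collisionProb A B μ Sig r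
      = ∫ x in whiten μ Sig '' minkowskiRegion A B ∩ whiten μ Sig '' truncationDomain μ Sig r,
          gaussianDensity 0 1 x := by
  have hT := measurableSet_truncationDomain μ hSig r
  have hf : truncatedGaussianDensity μ Sig r = (truncationDomain μ Sig r).indicator
      fun x => 1 / truncationRate μ Sig r * gaussianDensity μ Sig x := by
    funext x
    by_cases hx : x ∈ truncationDomain μ Sig r <;> simp [truncatedGaussianDensity, hx]
  rw [← Set.image_inter (bijective_whiten μ hSig).1, setIntegral_whiten_image μ hSig (hAB.inter hT),
    collisionProb, hf, setIntegral_indicator hT, integral_const_mul, ← mul_assoc,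
    mul_one_div_cancel (truncationRate_pos μ hSig hr).ne', one_mul]

/-! ### Compactness and convexity of the Minkowski region. -/

theorem IsConvexPolytope.isCompact {A : Set E3} (hA : IsConvexPolytope A) : IsCompact A := by
  obtain ⟨s, rfl⟩ := hA
  exact s.finite_toSet.isCompact_convexHull ℝ

theorem IsConvexPolytope.convex {A : Set E3} (hA : IsConvexPolytope A) : Convex ℝ A := by
  obtain ⟨s, rfl⟩ := hA
  exact convex_convexHull ℝ _

theorem isCompact_minkowskiRegion {A B : Set E3} (hA : IsConvexPolytope A)
    (hB : IsConvexPolytope B) : IsCompact (minkowskiRegion A B) :=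
  hA.isCompact.neg.add hB.isCompact

theorem convex_minkowskiRegion {A B : Set E3} (hA : IsConvexPolytope A)
    (hB : IsConvexPolytope B) : Convex ℝ (minkowskiRegion A B) :=
  hA.convex.neg.add hB.convex

/-! ### Orthonormal coordinates and the area measure on planes. -/

/-- The point with coordinates `(t, u 0, u 1)` in the orthonormal basis `b`. -/
noncomputable def coordPoint (b : OrthonormalBasis (Fin 3) ℝ E3) (u : Fin 2 → ℝ) (t : ℝ) : E3 :=
  b.repr.symm (WithLp.toLp 2 ![t, u 0, u 1])

/-- The last two coordinates of a point in the orthonormal basis `b`. -/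
noncomputable def coordTail (b : OrthonormalBasis (Fin 3) ℝ E3) (x : E3) : Fin 2 → ℝ :=
  ![inner ℝ (b 1) x, inner ℝ (b 2) x]

/-- The point over `u`, in the direction of `b 0`, of the plane `⟪n, x⟫ = a`. -/
noncomputable def planeLift (b : OrthonormalBasis (Fin 3) ℝ E3) (n : E3) (a : ℝ)
    (u : Fin 2 → ℝ) : E3 :=
  coordPoint b u ((a - inner ℝ n (b 1) * u 0 - inner ℝ n (b 2) * u 1) / inner ℝ n (b 0))

section Coordinates

variable (b : OrthonormalBasis (Fin 3) ℝ E3)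

theorem exists_orthonormalBasis_zero_eq {n : E3} (hn : ‖n‖ = 1) :
    ∃ b : OrthonormalBasis (Fin 3) ℝ E3, b 0 = n := by
  have hv : Orthonormal ℝ (({0} : Set (Fin 3)).domRestrict fun _ => n) :=
    ⟨fun _ => hn, fun i j hij => (hij (Subsingleton.elim i j)).elim⟩
  obtain ⟨b, hb⟩ := hv.exists_orthonormalBasis_extension_of_card_eq (by simp)
  exact ⟨b, hb 0 rfl⟩

theorem inner_coordPoint_zero (u : Fin 2 → ℝ) (t : ℝ) : inner ℝ (b 0) (coordPoint b u t) = t := by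
  rw [← b.repr_apply_apply]; simp [coordPoint]

theorem inner_coordPoint_one (u : Fin 2 → ℝ) (t : ℝ) :
    inner ℝ (b 1) (coordPoint b u t) = u 0 := by
  rw [← b.repr_apply_apply]; simp [coordPoint]

theorem inner_coordPoint_two (u : Fin 2 → ℝ) (t : ℝ) :
    inner ℝ (b 2) (coordPoint b u t) = u 1 := by
  rw [← b.repr_apply_apply]; simp [coordPoint]

theorem coordTail_coordPoint (u : Fin 2 → ℝ) (t : ℝ) : coordTail b (coordPoint b u t) = u := by
  ext i
  fin_cases i
  · simp [coordTail, inner_coordPoint_one]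
  · simp [coordTail, inner_coordPoint_two]

theorem coordPoint_coordTail (x : E3) : coordPoint b (coordTail b x) (inner ℝ (b 0) x) = x := by
  rw [coordPoint, LinearIsometryEquiv.symm_apply_eq]
  ext i
  rw [b.repr_apply_apply]
  fin_cases i <;> simp [coordTail]

theorem inner_eq_sum_coord (n x : E3) :
    inner ℝ n x = inner ℝ n (b 0) * inner ℝ (b 0) x + inner ℝ n (b 1) * inner ℝ (b 1) x
      + inner ℝ n (b 2) * inner ℝ (b 2) x := by
  rw [← b.sum_inner_mul_inner, Fin.sum_univ_three]

theorem inner_coordPoint (n : E3) (u : Fin 2 → ℝ) (t : ℝ) :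
    inner ℝ n (coordPoint b u t)
      = inner ℝ n (b 0) * t + inner ℝ n (b 1) * u 0 + inner ℝ n (b 2) * u 1 := by
  rw [inner_eq_sum_coord b, inner_coordPoint_zero, inner_coordPoint_one, inner_coordPoint_two]

theorem norm_coordPoint_sq (u : Fin 2 → ℝ) (t : ℝ) :
    ‖coordPoint b u t‖ ^ 2 = t ^ 2 + u 0 ^ 2 + u 1 ^ 2 := by
  rw [coordPoint, LinearIsometryEquiv.norm_map, EuclideanSpace.norm_sq_eq, Fin.sum_univ_three]
  simp

theorem coordPoint_sub (u v : Fin 2 → ℝ) (s t : ℝ) :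
    coordPoint b u s - coordPoint b v t = coordPoint b (u - v) (s - t) := by
  rw [coordPoint, coordPoint, coordPoint, ← map_sub]
  congr 1
  ext i
  fin_cases i <;> simp

theorem coordPoint_zero_left (t : ℝ) : coordPoint b 0 t = t • b 0 := by
  rw [coordPoint, LinearIsometryEquiv.symm_apply_eq]
  ext i
  fin_cases i <;> simp

theorem continuous_coordPoint :
    Continuous fun p : ℝ × (Fin 2 → ℝ) => coordPoint b p.2 p.1 := by
  refine b.repr.symm.continuous.comp ((PiLp.continuous_toLp 2 _).comp (continuous_pi fun i => ?_))
  fin_cases i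
  · exact continuous_fst
  · exact (continuous_apply 0).comp continuous_snd
  · exact (continuous_apply 1).comp continuous_snd

theorem continuous_planeLift (n : E3) (a : ℝ) : Continuous (planeLift b n a) :=
  (continuous_coordPoint b).comp (.prodMk (by fun_prop) continuous_id)

theorem measurePreserving_coordPoint :
    MeasurePreserving fun p : ℝ × (Fin 2 → ℝ) => coordPoint b p.2 p.1 := by
  have h1 := (volume_preserving_piFinSuccAbove (fun _ : Fin 3 => ℝ) 0).symm
  have h := b.measurePreserving_repr_symm.comp ((PiLp.volume_preserving_toLp (Fin 3)).comp h1)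
  convert! h using 1
  funext p
  simp only [Function.comp_apply, coordPoint]
  congr 2
  ext i
  fin_cases i <;> rfl

/-- The slice is an isometric copy of the Euclidean plane, where two-dimensional Hausdorff measure
is Lebesgue measure. -/
theorem map_coordPoint_eq_restrict (a : ℝ) :
    Measure.map (fun v => coordPoint b v a) volume
      = (Measure.euclideanHausdorffMeasure 2).restrict {x : E3 | inner ℝ (b 0) x = a} := by
  have hiso : Isometry fun w : EuclideanSpace ℝ (Fin 2) => coordPoint b w.ofLp a := by
    refine Isometry.of_dist_eq fun v w => ?_
    rw [dist_eq_norm, dist_eq_norm, coordPoint_sub,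
      ← sq_eq_sq₀ (norm_nonneg _) (norm_nonneg _), norm_coordPoint_sq, EuclideanSpace.norm_sq_eq,
      Fin.sum_univ_two]
    simp
  have hrange : Set.range (fun w : EuclideanSpace ℝ (Fin 2) => coordPoint b w.ofLp a)
      = {x : E3 | inner ℝ (b 0) x = a} := by
    ext x
    constructor
    · rintro ⟨w, rfl⟩
      exact inner_coordPoint_zero b _ _
    · rintro rfl
      exact ⟨WithLp.toLp 2 (coordTail b x), coordPoint_coordTail b x⟩
  rw [← hrange, ← hiso.map_euclideanHausdorffMeasure,
    EuclideanSpace.euclideanHausdorffMeasure_eq_volume,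
    ← (PiLp.volume_preserving_toLp (Fin 2)).map_eq,
    Measure.map_map hiso.continuous.measurable (PiLp.volume_preserving_toLp (Fin 2)).measurable]
  rfl

theorem coordTail_planeLift (n : E3) (a : ℝ) (u : Fin 2 → ℝ) :
    coordTail b (planeLift b n a u) = u :=
  coordTail_coordPoint b _ _

theorem planeLift_coordTail {n : E3} (hn : inner ℝ n (b 0) ≠ 0) (x : E3) :
    planeLift b n (inner ℝ n x) (coordTail b x) = x := by
  conv_rhs => rw [← coordPoint_coordTail b x]
  rw [planeLift, inner_eq_sum_coord b n x]
  congr 1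
  simp only [coordTail, Matrix.cons_val_zero, Matrix.cons_val_one]
  field_simp
  ring

/-- A cofactor of an orthogonal matrix equals, up to sign, the corresponding entry, because the
adjugate is det times the transpose. -/
theorem abs_det_tail_inner (b' : OrthonormalBasis (Fin 3) ℝ E3) :
    |(Matrix.of fun j k : Fin 2 => inner ℝ (b j.succ) (b' k.succ)).det|
      = |inner ℝ (b' 0) (b 0)| := by
  set O := b.toBasis.toMatrix b' with hO
  have hOij : ∀ i j, O i j = inner ℝ (b i) (b' j) := fun i j => by
    rw [hO, Module.Basis.toMatrix_apply, b.coe_toBasis_repr_apply, b.repr_apply_apply]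
  have hmem : O ∈ Matrix.orthogonalGroup (Fin 3) ℝ :=
    b.toMatrix_orthonormalBasis_mem_orthogonal b'
  have hdet : |O.det| = 1 := by
    rcases b.det_to_matrix_orthonormalBasis_real b' with h | h <;>
      rw [Module.Basis.det_apply] at h <;> rw [hO, h] <;> simp
  have hadj : O.adjugate = O.det • O.transpose := by
    -- Multiplying adj(O) O = det(O) 1 on the right by Oᵀ cancels O Oᵀ.
    have h := congrArg (· * O.transpose) (Matrix.adjugate_mul O)
    simp only [Matrix.mul_assoc] at h
    rw [(Matrix.mem_orthogonalGroup_iff _ _).1 hmem] at h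
    simpa using h
  have h00 := congrFun (congrFun hadj 0) 0
  rw [Matrix.adjugate_fin_three] at h00
  simp only [Matrix.of_apply, Matrix.cons_val_zero, Matrix.smul_apply, Matrix.transpose_apply,
    smul_eq_mul, Matrix.cons_val', hOij] at h00
  rw [Matrix.det_fin_two]
  simp only [Matrix.of_apply, Fin.succ_zero_eq_one, Fin.succ_one_eq_two]
  rw [h00, abs_mul, hdet, one_mul, real_inner_comm]

/-- Area formula for a plane as a graph: projecting along `b 0` shrinks area by the cosine |n·b 0|.
A basis `b'` starting with the normal parametrises the plane isometrically; passing to the projected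
coordinates is affine, with a linear part whose determinant is ± that cosine. -/
theorem map_planeLift_eq_smul_restrict {n : E3} (hn1 : ‖n‖ = 1) (hn : inner ℝ n (b 0) ≠ 0)
    (a : ℝ) :
    Measure.map (planeLift b n a) volume = ENNReal.ofReal |inner ℝ n (b 0)| •
      (Measure.euclideanHausdorffMeasure 2).restrict {x : E3 | inner ℝ n x = a} := by
  obtain ⟨b', rfl⟩ := exists_orthonormalBasis_zero_eq hn1
  set M : Matrix (Fin 2) (Fin 2) ℝ := Matrix.of fun j k => inner ℝ (b j.succ) (b' k.succ) with hM
  have habs : |M.det| = |inner ℝ (b' 0) (b 0)| := abs_det_tail_inner b b'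
  have hM0 : M.det ≠ 0 := by rwa [← abs_pos, habs, abs_pos]
  have hcomp : (fun v => coordPoint b' v a)
      = planeLift b (b' 0) a ∘ (fun w => w + coordTail b (coordPoint b' 0 a)) ∘ Matrix.toLin' M := by
    funext v
    have htail : coordTail b (coordPoint b' v a)
        = Matrix.toLin' M v + coordTail b (coordPoint b' 0 a) := by
      ext j
      fin_cases j <;>
        simp [coordTail, inner_coordPoint b', hM] <;> ring
    have h := planeLift_coordTail b hn (coordPoint b' v a)
    rw [inner_coordPoint_zero, htail] at h
    exact h.symm
  have hlin : Measurable (Matrix.toLin' M) :=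
    (Matrix.toLin' M).continuous_of_finiteDimensional.measurable
  have hlift := (continuous_planeLift b (b' 0) a).measurable
  rw [← map_coordPoint_eq_restrict, hcomp, ← Measure.map_map hlift (by fun_prop),
    ← Measure.map_map (by fun_prop) hlin, Real.map_matrix_volume_pi_eq_smul_volume_pi hM0,
    Measure.map_smul, map_add_right_eq_self, Measure.map_smul, smul_smul, ← habs,
    ← ENNReal.ofReal_mul (abs_nonneg _), ← abs_mul, mul_inv_cancel₀ hM0]
  simp

end Coordinates

/-! ### Generic lines along `b 0` and the flux as an integral over them. -/

section Fibers

variable (b : OrthonormalBasis (Fin 3) ℝ E3)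

theorem isLinearMap_coordTail : IsLinearMap ℝ (coordTail b) where
  map_add x y := by
    ext i
    fin_cases i <;> simp [coordTail, inner_add_right]
  map_smul a x := by
    ext i
    fin_cases i <;> simp [coordTail, inner_smul_right]

theorem continuous_coordTail : Continuous (coordTail b) := by
  refine continuous_pi fun i => ?_
  fin_cases i <;> simp only [coordTail, Fin.zero_eta, Fin.mk_one, Matrix.cons_val_zero,
    Matrix.cons_val_one] <;> fun_prop

theorem inner_coordPoint_sub_coordPoint (n : E3) (u : Fin 2 → ℝ) (s t : ℝ) :
    inner ℝ n (coordPoint b u s - coordPoint b u t) = (s - t) * inner ℝ n (b 0) := by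
  rw [coordPoint_sub, sub_self, coordPoint_zero_left, inner_smul_right]

/-- Almost every line in the direction of `b 0` that meets a convex body meets its interior. -/
theorem ae_forall_coordPoint_mem_interior {P : Set E3} (hP : Convex ℝ P)
    (hPi : (interior P).Nonempty) :
    ∀ᵐ u : Fin 2 → ℝ, (∃ t, coordPoint b u t ∈ P) → ∃ t, coordPoint b u t ∈ interior P := by
  have hD : Convex ℝ (coordTail b '' interior P) := hP.interior.is_linear_image
    (isLinearMap_coordTail b)
  -- The shadow of the interior is convex, so its frontier is null; every other point in the shadow
  -- of `P` lies under an interior point.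
  filter_upwards [compl_mem_ae_iff.2 (hD.addHaar_frontier volume)] with u hu ⟨t, ht⟩
  have hcl : u ∈ closure (coordTail b '' interior P) := by
    refine image_closure_subset_closure_image (continuous_coordTail b)
      ⟨coordPoint b u t, ?_, coordTail_coordPoint b u t⟩
    rw [hP.closure_interior_eq_closure_of_nonempty_interior hPi]
    exact subset_closure ht
  have hin : u ∈ interior (coordTail b '' interior P) := by
    by_contra h
    exact hu ⟨hcl, h⟩
  obtain ⟨x, hx, rfl⟩ := interior_subset hin
  exact ⟨inner ℝ (b 0) x, by rwa [coordPoint_coordTail]⟩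

/-- Almost no line in the direction of `b 0` meets a given plane that is parallel to `b 0`. -/
theorem ae_forall_inner_coordPoint_ne {n : E3} (hn : n ≠ 0) (hn0 : inner ℝ n (b 0) = 0) (a : ℝ) :
    ∀ᵐ u : Fin 2 → ℝ, ∀ t, inner ℝ n (coordPoint b u t) ≠ a := by
  let l : (Fin 2 → ℝ) →ₗ[ℝ] ℝ :=
    inner ℝ n (b 1) • LinearMap.proj 0 + inner ℝ n (b 2) • LinearMap.proj 1
  let A : AffineSubspace ℝ (Fin 2 → ℝ) := (AffineSubspace.mk' a ⊥).comap l.toAffineMap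
  have hl : ∀ u, l u = inner ℝ n (b 1) * u 0 + inner ℝ n (b 2) * u 1 := fun u => rfl
  have hmem : ∀ u, u ∈ A ↔ l u = a := fun u => by
    simp [A, AffineSubspace.mem_comap, AffineSubspace.mem_mk', sub_eq_zero]
  have hA : A ≠ ⊤ := by
    intro h
    have hall : ∀ u, l u = a := fun u => (hmem u).1 (h ▸ AffineSubspace.mem_top ℝ _ u)
    -- If the functional were constantly `a`, its values at 0 and at the two unit vectors would make
    -- all coordinates of `n` vanish.
    have h0 := hall 0
    have h1 := hall ![1, 0]
    have h2 := hall ![0, 1]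
    simp only [hl, Pi.zero_apply, mul_zero, add_zero, Matrix.cons_val_zero, Matrix.cons_val_one,
      mul_one, zero_add] at h0 h1 h2
    apply hn
    rw [← inner_self_eq_zero (𝕜 := ℝ), inner_eq_sum_coord b, hn0, h1, h2, ← h0]
    ring
  filter_upwards [compl_mem_ae_iff.2 (Measure.addHaar_affineSubspace volume A hA)] with u hu t ht
  refine hu ((hmem u).2 ?_)
  rw [← ht, inner_coordPoint, hn0, hl]
  ring

theorem ae_planeLift_notMem {n : E3} (hn1 : ‖n‖ = 1) (hn : inner ℝ n (b 0) ≠ 0) (a : ℝ)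
    {s : Set E3} (hs : MeasurableSet s) (hs0 : Measure.euclideanHausdorffMeasure 2 s = 0) :
    ∀ᵐ u : Fin 2 → ℝ, planeLift b n a u ∉ s := by
  refine measure_eq_zero_iff_ae_notMem.1 (?_ : volume (planeLift b n a ⁻¹' s) = 0)
  rw [← Measure.map_apply (continuous_planeLift b n a).measurable hs,
    map_planeLift_eq_smul_restrict b hn1 hn, Measure.smul_apply, Measure.restrict_apply hs,
    measure_mono_null Set.inter_subset_left hs0, smul_zero]

/-- The signed contribution to a flux along `b 0` of the point over `u` of the part `s` of a
plane. -/
noncomputable def fiberFlux (f : ℝ → ℝ) (n : E3) (a : ℝ) (s : Set E3) (u : Fin 2 → ℝ) : ℝ :=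
  Real.sign (inner ℝ n (b 0)) *
    (planeLift b n a ⁻¹' s).indicator (fun u => f (inner ℝ (b 0) (planeLift b n a u))) u

theorem integrable_fiberFlux {f : ℝ → ℝ} (hf : Continuous f) (n : E3) (a : ℝ) {s : Set E3}
    (hs : IsCompact s) : Integrable (fiberFlux b f n a s) := by
  have hlift := continuous_planeLift b n a
  have hc : IsCompact (planeLift b n a ⁻¹' s) := by
    refine (hs.image (continuous_coordTail b)).of_isClosed_subset (hs.isClosed.preimage hlift) ?_
    exact fun u hu => ⟨_, hu, coordTail_planeLift b n a u⟩
  refine Integrable.const_mul ?_ _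
  rw [integrable_indicator_iff hc.measurableSet]
  exact (hf.comp (continuous_const.inner hlift)).continuousOn.integrableOn_compact hc

/-- The cosine of the area formula and the sign in `fiberFlux` combine to n·b 0. For a plane
parallel to `b 0` both sides vanish, because `Real.sign 0 = 0`; the division by zero in `planeLift`
is then harmless. -/
theorem integral_fiberFlux {f : ℝ → ℝ} (hf : Continuous f) {n : E3} (hn1 : ‖n‖ = 1) (a : ℝ)
    {s : Set E3} (hs : MeasurableSet s) (hsa : ∀ x ∈ s, inner ℝ n x = a) :
    ∫ u, fiberFlux b f n a s u
      = ∫ x in s, f (inner ℝ (b 0) x) * inner ℝ n (b 0) ∂Measure.euclideanHausdorffMeasure 2 := by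
  by_cases hn : inner ℝ n (b 0) = 0
  · simp [fiberFlux, hn]
  have hlift := continuous_planeLift b n a
  have hfc : Continuous fun x : E3 => f (inner ℝ (b 0) x) :=
    hf.comp (continuous_const.inner continuous_id)
  have hrestrict : ((Measure.euclideanHausdorffMeasure 2).restrict
      {x : E3 | inner ℝ n x = a}).restrict s = (Measure.euclideanHausdorffMeasure 2).restrict s := by
    rw [Measure.restrict_restrict hs,
      Set.inter_eq_left.2 (show s ⊆ {x : E3 | inner ℝ n x = a} from hsa)]
  simp only [fiberFlux]
  rw [integral_const_mul, integral_indicator (hs.preimage hlift.measurable),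
    ← setIntegral_map (f := fun x => f (inner ℝ (b 0) x)) hs hfc.aestronglyMeasurable
      hlift.measurable.aemeasurable, map_planeLift_eq_smul_restrict b hn1 hn,
    Measure.restrict_smul, hrestrict, integral_smul_measure, integral_mul_const,
    ENNReal.toReal_ofReal (abs_nonneg _), smul_eq_mul, ← mul_assoc, mul_comm (Real.sign _),
    mul_comm _ (inner ℝ n (b 0))]
  congr 1
  rcases lt_or_gt_of_ne hn with h | h
  · rw [Real.sign_of_neg h, abs_of_neg h]; ring
  · rw [Real.sign_of_pos h, abs_of_pos h]; ring

theorem planeLift_eq_of_mem {n : E3} (hn : inner ℝ n (b 0) ≠ 0) {u : Fin 2 → ℝ} {t a : ℝ}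
    (h : inner ℝ n (coordPoint b u t) = a) : planeLift b n a u = coordPoint b u t := by
  rw [← h]
  have := planeLift_coordTail b hn (coordPoint b u t)
  rwa [coordTail_coordPoint] at this

theorem fiberFlux_eq {f : ℝ → ℝ} {n : E3} {a : ℝ} {s : Set E3} {u : Fin 2 → ℝ} {t : ℝ}
    (h : planeLift b n a u = coordPoint b u t) (hs : coordPoint b u t ∈ s) :
    fiberFlux b f n a s u = Real.sign (inner ℝ n (b 0)) * f t := by
  rw [fiberFlux, Set.indicator_of_mem (by rwa [Set.mem_preimage, h]), h, inner_coordPoint_zero]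

theorem fiberFlux_eq_zero {f : ℝ → ℝ} {n : E3} {a : ℝ} {s : Set E3} {u : Fin 2 → ℝ}
    (h : planeLift b n a u ∉ s) : fiberFlux b f n a s u = 0 := by
  rw [fiberFlux, Set.indicator_of_notMem (by rwa [Set.mem_preimage]), mul_zero]

end Fibers

/-! ### The divergence inequality, line by line. -/

section Body

variable (b : OrthonormalBasis (Fin 3) ℝ E3) {P : Set E3}

/-- The points of a compact set over `u` have a lowest and a highest one. If some point over `u` is
interior, these are different, and the highest one lies on the boundary. -/
theorem exists_fiber_bounds (hPc : IsCompact P) {u : Fin 2 → ℝ}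
    (hi : ∃ t, coordPoint b u t ∈ interior P) :
    ∃ lo hi : ℝ, lo < hi ∧ coordPoint b u lo ∈ P ∧ coordPoint b u hi ∈ frontier P ∧
      ∀ t, coordPoint b u t ∈ P → t ∈ Set.Icc lo hi := by
  have hcont : Continuous (coordPoint b u) :=
    (continuous_coordPoint b).comp (.prodMk continuous_id continuous_const)
  set J : Set ℝ := coordPoint b u ⁻¹' P with hJ
  set U : Set ℝ := coordPoint b u ⁻¹' interior P with hU
  have hUo : IsOpen U := isOpen_interior.preimage hcont
  have hUJ : U ⊆ J := Set.preimage_mono interior_subset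
  have hUn : U.Nonempty := hi
  have hJc : IsCompact J :=
    (hPc.image (continuous_const.inner continuous_id : Continuous fun x : E3 =>
      inner ℝ (b 0) x)).of_isClosed_subset (hPc.isClosed.preimage hcont)
      fun t ht => ⟨_, ht, inner_coordPoint_zero b u t⟩
  have hbounds : ∀ t ∈ J, t ∈ Set.Icc (sInf J) (sSup J) := fun t ht =>
    ⟨csInf_le hJc.bddBelow ht, le_csSup hJc.bddAbove ht⟩
  have hJn : J.Nonempty := hUn.mono hUJ
  -- An open subset of a half-line bounded above cannot contain its endpoint.
  have hsup : sSup J ∉ U := by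
    intro h
    have hsub : U ⊆ Set.Iio (sSup J) := by
      rw [← interior_Iic]
      exact interior_maximal (fun t ht => (hbounds t (hUJ ht)).2) hUo
    exact lt_irrefl _ (Set.mem_Iio.1 (hsub h))
  refine ⟨sInf J, sSup J, ?_, hJc.sInf_mem hJn, ?_, hbounds⟩
  · obtain ⟨t, ht⟩ := hUn
    have htb := hbounds t (hUJ ht)
    refine lt_of_le_of_ne (htb.1.trans htb.2) fun heq => hsup ?_
    rwa [le_antisymm (heq ▸ htb.1) htb.2]
  · rw [hPc.isClosed.frontier_eq]
    exact ⟨hJc.sSup_mem hJn, hsup⟩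

variable {f f' : ℝ → ℝ} {r : ℝ} {ι : Type*} [Fintype ι] {S : ι → Affine.Triangle ℝ E3} {n : ι → E3}

/-- The one-dimensional inequality over a generic point `u` behind
`setIntegral_deriv_le_sum_flux`. -/
theorem integral_fiber_le_sum_fiberFlux (hPc : IsCompact P)
    (hf : ∀ t, HasDerivAt f (f' t) t) (hfc' : Continuous f') (hf'0 : ∀ t, 0 ≤ f' t)
    (hf0 : ∀ t, 0 ≤ f t) (hneg : ∀ x ∈ P, inner ℝ (b 0) x ≤ 0)
    (hS : IsBoundaryTriangulation P S n) {u : Fin 2 → ℝ}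
    (hu : (∃ t, coordPoint b u t ∈ P) → ∃ t, coordPoint b u t ∈ interior P)
    (hvert : ∀ i, inner ℝ (n i) (b 0) = 0 →
      ∀ t, inner ℝ (n i) (coordPoint b u t) ≠ inner ℝ (n i) ((S i).points 0))
    (hover : ∀ i j, i ≠ j → inner ℝ (n i) (b 0) ≠ 0 →
      planeLift b (n i) (inner ℝ (n i) ((S i).points 0)) u ∉
        (S i).closedInterior ∩ (S j).closedInterior) :
    ∫ t, (P ∩ Metric.closedBall 0 r).indicator (fun x => f' (inner ℝ (b 0) x)) (coordPoint b u t)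
      ≤ ∑ i, fiberFlux b f (n i) (inner ℝ (n i) ((S i).points 0))
          ((S i).closedInterior ∩ Metric.closedBall 0 r) u := by
  classical
  have hSP : ∀ i, (S i).closedInterior ⊆ P := fun i =>
    (Set.subset_iUnion _ i).trans (hS.cover.subset.trans hPc.isClosed.frontier_subset)
  set a : ι → ℝ := fun i => inner ℝ (n i) ((S i).points 0) with ha
  have hplane : ∀ i, ∀ x ∈ (S i).closedInterior, inner ℝ (n i) x = a i := fun i x hx => by
    rw [← sub_eq_zero, ha, ← inner_sub_right]
    exact hS.normal i x hx _ ((S i).point_mem_closedInterior 0)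
  have hlift : ∀ i, ∃ s, planeLift b (n i) (a i) u = coordPoint b u s := fun i => ⟨_, rfl⟩
  by_cases hne : ∃ t, coordPoint b u t ∈ P ∩ Metric.closedBall 0 r
  swap
  · push Not at hne
    rw [Finset.sum_eq_zero, integral_eq_zero_of_ae]
    · exact ae_of_all _ fun t => Set.indicator_of_notMem (hne t) _
    · intro i _
      refine fiberFlux_eq_zero b fun h => ?_
      obtain ⟨s, hs⟩ := hlift i
      rw [hs] at h
      exact hne s ⟨hSP i h.1, h.2⟩
  obtain ⟨t₀, ht₀P, ht₀K⟩ := hne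
  obtain ⟨lo, hi, hlt, hlo, hhi, hmem⟩ := exists_fiber_bounds b hPc (hu ⟨t₀, ht₀P⟩)
  have hhiP : coordPoint b u hi ∈ P := hPc.isClosed.frontier_subset hhi
  have hhi0 : hi ≤ 0 := by simpa [inner_coordPoint_zero] using hneg _ hhiP
  -- The top of the fiber is in the ball as soon as some point of the fiber is: t₀ ≤ hi ≤ 0 gives
  -- hi² ≤ t₀², and the other coordinates agree. This is where the half-space condition enters.
  have hhiK : coordPoint b u hi ∈ Metric.closedBall (0 : E3) r := by
    rw [mem_closedBall_zero_iff] at ht₀K ⊢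
    refine le_trans ?_ ht₀K
    rw [← sq_le_sq₀ (norm_nonneg _) (norm_nonneg _), norm_coordPoint_sq, norm_coordPoint_sq]
    have h := (hmem t₀ ht₀P).2
    gcongr ?_ + _ + _
    nlinarith
  have hleft : ∫ t, (P ∩ Metric.closedBall 0 r).indicator (fun x => f' (inner ℝ (b 0) x))
      (coordPoint b u t) ≤ f hi - f lo := by
    have hint : ∫ t in Set.Icc lo hi, f' t = f hi - f lo := by
      rw [integral_Icc_eq_integral_Ioc, ← intervalIntegral.integral_of_le hlt.le,
        intervalIntegral.integral_eq_sub_of_hasDerivAt (fun t _ => hf t)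
          (hfc'.intervalIntegrable _ _)]
    rw [← hint, ← integral_indicator measurableSet_Icc]
    refine integral_mono_of_nonneg (ae_of_all _ fun t => Set.indicator_nonneg
      (fun x _ => hf'0 _) _) ?_ (ae_of_all _ fun t => ?_)
    · rw [integrable_indicator_iff measurableSet_Icc]
      exact hfc'.continuousOn.integrableOn_compact isCompact_Icc
    · by_cases ht : coordPoint b u t ∈ P ∩ Metric.closedBall 0 r
      · simp only [Set.indicator_of_mem ht, Set.indicator_of_mem (hmem t ht.1),
          inner_coordPoint_zero, le_refl]
      · simp only [Set.indicator_of_notMem ht]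
        exact Set.indicator_nonneg (fun t _ => hf'0 t) t
  obtain ⟨i₀, hi₀⟩ := Set.mem_iUnion.1 (hS.cover.symm.subset hhi)
  -- The outward normal at the top, tested against the lower point, has nonnegative `b 0` component;
  -- zero is excluded by genericity of `u`.
  have hpos : 0 < inner ℝ (n i₀) (b 0) := by
    have h1 := hS.outward i₀ _ hi₀ _ hlo
    rw [inner_coordPoint_sub_coordPoint] at h1
    refine lt_of_le_of_ne (by nlinarith) fun h0 => ?_
    exact hvert i₀ h0.symm hi (hplane i₀ _ hi₀)
  have htop : fiberFlux b f (n i₀) (a i₀) ((S i₀).closedInterior ∩ Metric.closedBall 0 r) u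
      = f hi := by
    rw [fiberFlux_eq b (planeLift_eq_of_mem b hpos.ne' (hplane i₀ _ hi₀)) (.intro hi₀ hhiK),
      Real.sign_of_pos hpos, one_mul]
  -- Further upward-facing triangles only increase the sum, so just one of them has to be
  -- identified.
  have hnonneg : ∀ i, 0 ≤ inner ℝ (n i) (b 0) →
      0 ≤ fiberFlux b f (n i) (a i) ((S i).closedInterior ∩ Metric.closedBall 0 r) u := fun i h => by
    refine mul_nonneg ?_ (Set.indicator_nonneg (fun _ _ => hf0 _) _)
    rcases h.eq_or_lt with h | h
    · rw [← h, Real.sign_zero]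
    · rw [Real.sign_of_pos h]; exact zero_le_one
  -- Testing the outward condition against the lowest point shows that a downward-facing triangle
  -- can meet the line only there.
  have hbot : ∀ j, inner ℝ (n j) (b 0) < 0 →
      planeLift b (n j) (a j) u ∈ (S j).closedInterior →
      planeLift b (n j) (a j) u = coordPoint b u lo := by
    intro j hj hjS
    obtain ⟨s, hs⟩ := hlift j
    rw [hs] at hjS ⊢
    have h1 := hS.outward j _ hjS _ hlo
    rw [inner_coordPoint_sub_coordPoint] at h1
    have h2 := (hmem s (hSP j hjS)).1
    rw [le_antisymm (by nlinarith) h2]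
  refine hleft.trans ?_
  -- If a downward-facing triangle is hit inside the ball, it contributes -f(lo). Otherwise nothing
  -- negative appears, and f(hi) - f(lo) ≤ f(hi) suffices.
  by_cases hex : ∃ j, inner ℝ (n j) (b 0) < 0 ∧
      planeLift b (n j) (a j) u ∈ (S j).closedInterior ∩ Metric.closedBall 0 r
  · obtain ⟨j₀, hj₀, hj₀S⟩ := hex
    have hj₀lo := hbot j₀ hj₀ hj₀S.1
    have hsum : f hi - f lo = ∑ i, ((if i = i₀ then f hi else 0) + if i = j₀ then -f lo else 0) := by
      rw [Finset.sum_add_distrib]; simp [sub_eq_add_neg]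
    rw [hsum]
    refine Finset.sum_le_sum fun i _ => ?_
    by_cases hij : i = j₀
    · subst hij
      have hii : i ≠ i₀ := by rintro rfl; exact lt_asymm hpos hj₀
      rw [if_neg hii, if_pos rfl, fiberFlux_eq b hj₀lo (hj₀lo ▸ hj₀S), Real.sign_of_neg hj₀]
      simp
    rw [if_neg hij, add_zero]
    split_ifs with hii
    · rw [hii, htop]
    · rcases lt_or_ge (inner ℝ (n i) (b 0)) 0 with h | h
      · refine (fiberFlux_eq_zero b fun hmemi => ?_).ge
        -- A second downward-facing triangle would share the lowest point with `j₀`, against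
        -- genericity; so -f(lo) is counted only once.
        refine hover i j₀ hij h.ne ⟨hmemi.1, ?_⟩
        have := hbot i h hmemi.1
        rw [this, ← hj₀lo]
        exact hj₀S.1
      · exact hnonneg i h
  · push Not at hex
    have hsum : f hi = ∑ i, if i = i₀ then f hi else 0 := by simp
    refine (sub_le_self _ (hf0 lo)).trans ?_
    conv_lhs => rw [hsum]
    refine Finset.sum_le_sum fun i _ => ?_
    split_ifs with hii
    · rw [hii, htop]
    · rcases lt_or_ge (inner ℝ (n i) (b 0)) 0 with h | h
      · exact (fiberFlux_eq_zero b (hex i h)).ge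
      · exact hnonneg i h

/-- A divergence inequality for the field `f (⟪b 0, x⟫) • b 0` on the part of a convex body `P` in
a ball: if `P` lies on the nonpositive side, the flux through the spherical part is nonpositive. -/
theorem setIntegral_deriv_le_sum_flux (hP : Convex ℝ P) (hPc : IsCompact P)
    (hPi : (interior P).Nonempty) (hf : ∀ t, HasDerivAt f (f' t) t) (hfc' : Continuous f')
    (hf'0 : ∀ t, 0 ≤ f' t) (hf0 : ∀ t, 0 ≤ f t) (hneg : ∀ x ∈ P, inner ℝ (b 0) x ≤ 0)
    (hS : IsBoundaryTriangulation P S n) :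
    ∫ x in P ∩ Metric.closedBall 0 r, f' (inner ℝ (b 0) x)
      ≤ ∑ i, ∫ x in (S i).closedInterior ∩ Metric.closedBall 0 r,
          f (inner ℝ (b 0) x) * inner ℝ (n i) (b 0) ∂Measure.euclideanHausdorffMeasure 2 := by
  have hfcont : Continuous f := continuous_iff_continuousAt.2 fun t => (hf t).continuousAt
  have hSc : ∀ i, IsCompact ((S i).closedInterior ∩ Metric.closedBall 0 r) := fun i =>
    (S i).isCompact_closedInterior.inter_right Metric.isClosed_closedBall
  have hKc : IsCompact (P ∩ Metric.closedBall 0 r) := hPc.inter_right Metric.isClosed_closedBall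
  have hplane : ∀ i, ∀ x ∈ (S i).closedInterior ∩ Metric.closedBall 0 r,
      inner ℝ (n i) x = inner ℝ (n i) ((S i).points 0) := fun i x hx => by
    rw [← sub_eq_zero, ← inner_sub_right]
    exact hS.normal i x hx.1 _ ((S i).point_mem_closedInterior 0)
  have hmp := measurePreserving_coordPoint b
  have hind : Integrable ((P ∩ Metric.closedBall 0 r).indicator fun x => f' (inner ℝ (b 0) x)) := by
    rw [integrable_indicator_iff hKc.measurableSet]
    exact (hfc'.comp (continuous_const.inner continuous_id)).continuousOn.integrableOn_compact hKc
  have hprod : Integrable fun p : ℝ × (Fin 2 → ℝ) =>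
      (P ∩ Metric.closedBall 0 r).indicator (fun x => f' (inner ℝ (b 0) x))
        (coordPoint b p.2 p.1) :=
    hmp.integrable_comp_of_integrable hind
  calc ∫ x in P ∩ Metric.closedBall 0 r, f' (inner ℝ (b 0) x)
      = ∫ p : ℝ × (Fin 2 → ℝ), (P ∩ Metric.closedBall 0 r).indicator
          (fun x => f' (inner ℝ (b 0) x)) (coordPoint b p.2 p.1) := by
        rw [← integral_indicator hKc.measurableSet]
        conv_lhs => rw [← hmp.map_eq]
        exact integral_map hmp.aemeasurable (hmp.map_eq ▸ hind.aestronglyMeasurable)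
    _ = ∫ u, ∫ t, (P ∩ Metric.closedBall 0 r).indicator (fun x => f' (inner ℝ (b 0) x))
          (coordPoint b u t) := integral_prod_symm _ hprod
    _ ≤ ∫ u, ∑ i, fiberFlux b f (n i) (inner ℝ (n i) ((S i).points 0))
          ((S i).closedInterior ∩ Metric.closedBall 0 r) u := by
        refine integral_mono_ae hprod.integral_prod_right
          (integrable_finsetSum _ fun i _ => integrable_fiberFlux b hfcont _ _ (hSc i)) ?_
        have h1 := ae_forall_coordPoint_mem_interior b hP hPi
        have h2 : ∀ᵐ u : Fin 2 → ℝ, ∀ i, inner ℝ (n i) (b 0) = 0 →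
            ∀ t, inner ℝ (n i) (coordPoint b u t) ≠ inner ℝ (n i) ((S i).points 0) := by
          refine ae_all_iff.2 fun i => ?_
          by_cases h0 : inner ℝ (n i) (b 0) = 0
          · have hni : n i ≠ 0 := by
              rw [← norm_ne_zero_iff, hS.unit i]; exact one_ne_zero
            filter_upwards [ae_forall_inner_coordPoint_ne b hni h0
              (inner ℝ (n i) ((S i).points 0))] with u hu _ using hu
          · exact ae_of_all _ fun u h => absurd h h0
        have h3 : ∀ᵐ u : Fin 2 → ℝ, ∀ i j, i ≠ j → inner ℝ (n i) (b 0) ≠ 0 →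
            planeLift b (n i) (inner ℝ (n i) ((S i).points 0)) u ∉
              (S i).closedInterior ∩ (S j).closedInterior := by
          refine ae_all_iff.2 fun i => ae_all_iff.2 fun j => ?_
          by_cases h : i ≠ j ∧ inner ℝ (n i) (b 0) ≠ 0
          · filter_upwards [ae_planeLift_notMem b (hS.unit i) h.2 (inner ℝ (n i) ((S i).points 0))
              ((S i).isClosed_closedInterior.inter (S j).isClosed_closedInterior).measurableSet
              (hS.overlap i j h.1)] with u hu _ _ using hu
          · exact ae_of_all _ fun u h1 h2 => absurd ⟨h1, h2⟩ h
        filter_upwards [h1, h2, h3] with u hu1 hu2 hu3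
        exact integral_fiber_le_sum_fiberFlux b hPc hf hfc' hf'0 hf0 hneg hS hu1 hu2 hu3
    _ = _ := by
        rw [integral_finsetSum _ fun i _ => integrable_fiberFlux b hfcont _ _ (hSc i)]
        refine Finset.sum_congr rfl fun i _ => ?_
        exact integral_fiberFlux b hfcont (hS.unit i) _ (hSc i).measurableSet (hplane i)

end Body

/-! ### The supporting half-space and the final estimate. -/

theorem norm_unitDir {d : E3} (hd : d ≠ 0) : ‖unitDir d‖ = 1 := by
  rw [unitDir, norm_smul, norm_inv, norm_norm, inv_mul_cancel₀ (norm_ne_zero_iff.2 hd)]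

/-- The variational inequality for the projection of 0 onto `V` gives d·y ≤ -‖d‖²; only the sign is
kept. -/
theorem IsMinDistVec.inner_unitDir_nonpos {V : Set E3} {d : E3} (hd : IsMinDistVec V d)
    (hV : Convex ℝ V) {y : E3} (hy : y ∈ V) : inner ℝ (unitDir d) y ≤ 0 := by
  have : Nonempty V := ⟨⟨y, hy⟩⟩
  have hinf : ‖(0 : E3) - -d‖ = ⨅ w : V, ‖(0 : E3) - w‖ := by
    refine le_antisymm (le_ciInf fun w => ?_)
      (ciInf_le (f := fun w : V => ‖(0 : E3) - w‖) ⟨0, ?_⟩ ⟨-d, hd.1⟩)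
    · simpa using hd.2 w w.2
    · rintro _ ⟨w, rfl⟩
      exact norm_nonneg _
  have h := (norm_eq_iInf_iff_real_inner_le_zero hV hd.1).1 hinf y hy
  rw [zero_sub, neg_neg, sub_neg_eq_add, inner_add_right] at h
  have h0 : 0 ≤ inner ℝ d d := real_inner_self_nonneg
  rw [unitDir, real_inner_smul_left]
  exact mul_nonpos_of_nonneg_of_nonpos (by positivity) (by linarith)

/-- The constants agree, 2(2π)^{-3/2} = (1/π)(2π)^{-1/2}, and the exponent grows when the components
of `x` orthogonal to `m` are dropped. -/
theorem two_mul_gaussianDensity_le {m : E3} (hm : ‖m‖ = 1) (x : E3) :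
    2 * gaussianDensity 0 1 x ≤ erfProfileDeriv (inner ℝ m x) := by
  have hsqrt : √((2 * Real.pi) ^ 3) = 2 * Real.pi * √(2 * Real.pi) := by
    rw [pow_succ, Real.sqrt_mul (by positivity), Real.sqrt_sq (by positivity)]
  have hconst : 2 * (1 / √((2 * Real.pi) ^ 3)) = 1 / Real.pi * (1 / √(2 * Real.pi)) := by
    rw [hsqrt]; field_simp
  have hinner : inner ℝ m x ^ 2 ≤ ‖x‖ ^ 2 := by
    have h := abs_real_inner_le_norm m x
    rw [hm, one_mul] at h
    exact sq_le_sq.2 (h.trans (le_abs_self _))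
  rw [gaussianDensity_zero_one, erfProfileDeriv, ← mul_assoc, hconst]
  gcongr ?_ * Real.exp ?_
  linarith

theorem flux_erfField (m : E3) (S : Affine.Triangle ℝ E3) (K : Set E3) (n : E3) :
    flux (erfField m) S K n = ∫ x in S.closedInterior ∩ K,
      erfProfile (inner ℝ m x) * inner ℝ n m ∂Measure.euclideanHausdorffMeasure 2 := by
  simp only [flux, erfField, erfProfile, real_inner_smul_left]
  simp only [real_inner_comm]

theorem two_mul_setIntegral_gaussianDensity_le_sum_flux {V : Set E3} (hV : Convex ℝ V)
    (hVc : IsCompact V) (hVi : (interior V).Nonempty) {d : E3} (hd : IsMinDistVec V d)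
    (hd0 : d ≠ 0) {ι : Type*} [Fintype ι] {S : ι → Affine.Triangle ℝ E3} {n : ι → E3}
    (hS : IsBoundaryTriangulation V S n) (r : ℝ) :
    2 * ∫ x in V ∩ Metric.closedBall 0 r, gaussianDensity 0 1 x
      ≤ ∑ i, flux (erfField (unitDir d)) (S i) (Metric.closedBall 0 r) (n i) := by
  obtain ⟨b, hb⟩ := exists_orthonormalBasis_zero_eq (norm_unitDir hd0)
  have h := setIntegral_deriv_le_sum_flux b (r := r) hV hVc hVi hasDerivAt_erfProfile
    continuous_erfProfileDeriv erfProfileDeriv_nonneg erfProfile_nonneg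
    (fun x hx => by rw [hb]; exact hd.inner_unitDir_nonpos hV hx) hS
  rw [hb] at h
  simp only [flux_erfField]
  refine le_trans ?_ h
  rw [← integral_const_mul]
  refine integral_mono (integrable_gaussianDensity_zero_one.integrableOn.const_mul 2) ?_
    fun x => two_mul_gaussianDensity_le (norm_unitDir hd0) x
  exact (continuous_erfProfileDeriv.comp
    (continuous_const.inner continuous_id)).continuousOn.integrableOn_compact
    (hVc.inter_right Metric.isClosed_closedBall)

theorem mainTheorem1
    (A B : Set E3) (hA : IsConvexPolytope A) (hB : IsConvexPolytope B)
    (hAB : (interior (minkowskiRegion A B)).Nonempty)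
    (μ : E3) (Sig : Matrix (Fin 3) (Fin 3) ℝ) (hSig : Sig.PosDef) (r : ℝ) (hr : 0 < r)
    (V'AB V'TG : Set E3)
    (hV'AB : V'AB = whiten μ Sig '' minkowskiRegion A B)
    (hV'TG : V'TG = whiten μ Sig '' truncationDomain μ Sig r)
    (d' : E3) (hd' : IsMinDistVec V'AB d') (hd'0 : d' ≠ 0)
    {ι : Type*} [Fintype ι] (S : ι → Affine.Triangle ℝ E3) (n : ι → E3)
    (hS : IsBoundaryTriangulation V'AB S n) :
    truncationRate μ Sig r * collisionProb A B μ Sig r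
        = ∫ x in V'AB ∩ V'TG, gaussianDensity 0 1 x ∧
    ∫ x in V'AB ∩ V'TG, gaussianDensity 0 1 x
        ≤ ∑ i, flux (erfField (unitDir d')) (S i) V'TG (n i)
          + Real.pi * (1 - truncationRate μ Sig r) * ‖d'‖ ^ 2 ∧
    (1 / 2 ≤ truncationRate μ Sig r →
      collisionProb A B μ Sig r
        ≤ ∑ i, flux (erfField (unitDir d')) (S i) V'TG (n i)
          + Real.pi * (1 - truncationRate μ Sig r) * ‖d'‖ ^ 2) ∧
    IsLUB (Set.range fun x => ‖erfField (unitDir d') x‖) (1 / Real.pi) := by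
  have hc := isCompact_minkowskiRegion hA hB
  have heq : truncationRate μ Sig r * collisionProb A B μ Sig r
      = ∫ x in V'AB ∩ V'TG, gaussianDensity 0 1 x := by
    rw [hV'AB, hV'TG]
    exact truncationRate_mul_collisionProb hc.measurableSet μ hSig hr
  have hball : V'TG = Metric.closedBall 0 r := by
    rw [hV'TG, whiten_image_truncationDomain μ hSig hr]
  have hconv : Convex ℝ V'AB := hV'AB ▸ convex_whiten_image μ Sig (convex_minkowskiRegion hA hB)
  have hcomp : IsCompact V'AB := hV'AB ▸ hc.image (continuous_whiten μ Sig)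
  have hint : (interior V'AB).Nonempty := hV'AB ▸ nonempty_interior_whiten_image μ hSig hAB
  have hflux := two_mul_setIntegral_gaussianDensity_le_sum_flux hconv hcomp hint hd' hd'0 hS r
  rw [← hball] at hflux
  have hnonneg : 0 ≤ ∫ x in V'AB ∩ V'TG, gaussianDensity 0 1 x :=
    integral_nonneg fun x => (gaussianDensity_zero_one_pos x).le
  have hpi : 0 ≤ Real.pi * (1 - truncationRate μ Sig r) * ‖d'‖ ^ 2 :=
    mul_nonneg (mul_nonneg Real.pi_pos.le (sub_nonneg.2 (truncationRate_le_one μ hSig hr)))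
      (sq_nonneg _)
  refine ⟨heq, by linarith, fun hη => ?_, isLUB_range_norm_erfField (norm_unitDir hd'0)⟩
  have hcol : 0 ≤ collisionProb A B μ Sig r :=
    nonneg_of_mul_nonneg_right (heq ▸ hnonneg) (truncationRate_pos μ hSig hr)
  -- With p the collision probability, p ≤ 2ηp because p ≥ 0 and 2η ≥ 1, and 2ηp is at most the
  -- total flux.
  nlinarith
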